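/- Let $r, k, s$ be integers with $k \ge 0$ and $0 < s \le r$. Let $V = C_1 \sqcup \dots \sqcup C_{k+1}$ be a finite set whose elements (vertices) are colored by $k+1$ colors, where each color class has $|C_i| = 2r-1$ elements. A subset $A \subseteq V$ is called a rainbow simplex if $|A \cap C_i| \le 1$ for every $i$. Let $\mathfrak{C}$ be the simplicial complex whose simplices are labeled by the tuples $(A_1, \dots, A_r; B)$ such that - $V = A_1 \sqcup \dots \sqcup A_r \sqcup B$ is a partition (empty parts are allowed) with $B \ne V$; - each $A_i$ is a rainbow simplex (in particular $|A_i| \le k+1$); - the number of indices $i$ with $|A_i| = k+1$ does not exceed $s$. The simplex with label $(A_1, \dots, A_r; B)$ is the join $A_1 * \dots * A_r$; that is, $\mathfrak{C}$ is a subcomplex of the $r$-fold join of the full simplex on $V$, the vertex set of the join is the disjoint union of $r$ copies of $V$, and the simplex consists of the elements of $A_i$ in the $i$-th copy, for $i = 1, \dots, r$. Then the geometric realization of $\mathfrak{C}$ is $(rk+s-2)$-connected. Here a space $X$ is called $n$-connected if, for every integer $l$ with $-1 \le l \le n$, every continuous map $S^l \to X$ extends to a continuous map $B^{l+1} \to X$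 (with $S^{-1} = \emptyset$ and $B^0$ a point, so that the case $l=-1$ says that $X$ is nonempty). -/

import Mathlib

open Finset

/-- The geometric realization of an abstract simplicial complex on a finite vertex type: the union,
inside the standard simplex (with the topology of `ι → ℝ`), of the closed simplices spanned by the
faces. -/
def geometricRealization {ι : Type*} [Fintype ι] (K : PreAbstractSimplicialComplex ι) :
    Set (ι → ℝ) :=
  {x | x ∈ stdSimplex ℝ ι ∧ ∃ σ ∈ K, ∀ v, v ∉ σ → x v = 0}

/-- A space `X` is `n`-connected (`n` an integer) if for every `l` with `-1 ≤ l ≤ n`, each continuous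
map from the sphere `S^l` to `X` extends to a continuous map from the ball `B^(l+1)` to `X`.
Here `j = l + 1`, so that `S^l` and `B^(l+1)` are the unit sphere and the closed unit ball of the
Euclidean space `ℝ^j`. For `j = 0` the sphere is empty and the ball is a point, so this case says
that `X` is nonempty. -/
def IsNConnected (n : ℤ) (X : Type*) [TopologicalSpace X] : Prop :=
  ∀ j : ℕ, (j : ℤ) ≤ n + 1 →
    ∀ f : C(Metric.sphere (0 : EuclideanSpace ℝ (Fin j)) 1, X),
      ∃ g : C(Metric.closedBall (0 : EuclideanSpace ℝ (Fin j)) 1, X),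
        ∀ x : Metric.sphere (0 : EuclideanSpace ℝ (Fin j)) 1,
          g ⟨x.1, Metric.sphere_subset_closedBall x.2⟩ = f x

section ConfigurationSpace

variable {V : Type*} {k r : ℕ}

/-- A set of vertices is a rainbow set if it contains at most one vertex of each color. -/
def IsRainbow (c : V → Fin (k + 1)) (A : Finset V) : Prop :=
  ∀ i, #{v ∈ A | c v = i} ≤ 1

theorem IsRainbow.subset {c : V → Fin (k + 1)} {A A' : Finset V} (h : IsRainbow c A)
    (hA : A' ⊆ A) : IsRainbow c A' :=
  fun i => (card_le_card (filter_subset_filter _ hA)).trans (h i)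

theorem IsRainbow.card_le {c : V → Fin (k + 1)} {A : Finset V} (h : IsRainbow c A) :
    #A ≤ k + 1 := by
  have h1 := card_eq_sum_card_fiberwise (f := c) (s := A) (t := univ) (fun _ _ => by simp)
  rw [h1]
  exact (sum_le_sum fun i _ => h i).trans (by simp)

variable [Fintype V] [DecidableEq V]

/-- The `i`-th component `A_i` of a simplex `σ = A_1 * ⋯ * A_r` of the `r`-fold join of the simplex
with vertex set `V`; the vertex set of this join is `Fin r × V`, the disjoint union of `r` copies
of `V`. -/
def joinPart (σ : Finset (Fin r × V)) (i : Fin r) : Finset V :=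
  {v | (i, v) ∈ σ}

/-- The configuration space of `r`-tuples of disjoint rainbow simplices, at most `s` of which have
`k + 1` vertices. The simplex with label `(A_1, …, A_r; B)` is the join `A_1 * ⋯ * A_r`, and `B` is
the complement of the union of the `A_i`, so `B ≠ V` says that the join is nonempty. -/
def configurationSpace (c : V → Fin (k + 1)) (r s : ℕ) :
    PreAbstractSimplicialComplex (Fin r × V) where
  faces := {σ | σ.Nonempty ∧
    (∀ i j, i ≠ j → Disjoint (joinPart σ i) (joinPart σ j)) ∧
    (∀ i, IsRainbow c (joinPart σ i)) ∧
    #{i | #(joinPart σ i) = k + 1} ≤ s}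
  isRelLowerSet_faces := by
    rintro σ ⟨hne, hd, hr, hs⟩
    refine ⟨hne, fun τ hτ hτne => ?_⟩
    have hsub : ∀ i, joinPart τ i ⊆ joinPart σ i := fun i v hv => by
      simp only [joinPart, mem_filter, mem_univ, true_and] at hv ⊢
      exact hτ hv
    refine ⟨hτne, fun i j hij => (hd i j hij).mono (hsub i) (hsub j),
      fun i => (hr i).subset (hsub i), (card_le_card fun i hi => ?_).trans hs⟩
    simp only [mem_filter, mem_univ, true_and] at hi ⊢
    exact le_antisymm (hr i).card_le (hi ▸ card_le_card (hsub i))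

end ConfigurationSpace

/-! A simplex places vertices into the slots of an array whose rows are the parts `A_i` and whose
columns are the colors: a slot is filled at most once, by a vertex of its color, and no vertex is
used twice. The bound on full parts says that the occupied slots contain at most `s` full rows. Such
slot sets are the independent sets of a matroid (`isIndepFamily_card_fullRows_le`), and some of them
have `r * k + s` elements (`exists_card_fullRows_le`).

The statement proved by induction, `morseBuilt_fillings`, concerns any matroid on the slots: if each
color with `m` slots has at least `2 * m - 1` vertices, and some independent set has `d` elements,
then the complex of fillings is `(d - 2)`-connected. Pick a slot `e`. If some independent set of
size `d` avoids `e`, remove all fillers of `e`: the deletion of `e` remains, and the links of the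
removed vertices come from the contraction of `e`, where `d` drops by one. Otherwise `e` can be
added to every independent set. Fix a vertex `v₀` of the color of `e`; after removing the other
placements of `v₀` and the other fillers of `e`, what remains is a cone with apex `v₀` in slot `e`.
The links again come from contractions, which lose one slot and at most two vertices of that color;
this is what `2 * m - 1` affords.

Connectivity is carried through the induction combinatorially, as `MorseBuilt`, for which gluing
along links is elementary (`MorseBuilt.of_deletion_link`). Topology enters only in
`MorseBuilt.isNConnected`: a free pair retracts away, and a sphere of small dimension can be pushed
off a large cell. -/

/-! ### Combinatorial connectivity of simplicial complexes -/

section MorseBuilt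

variable {X : Type*} [DecidableEq X]

/-- Families of finite sets that arise from the void family by adding successively pairs
`{τ, τ ∪ {x}}` with `τ` a free face, and single sets `σ` with at least `n + 2` elements all of whose
proper subsets are already present. -/
inductive MorseBuilt (n : ℤ) : Set (Finset X) → Prop
  | empty : MorseBuilt n ∅
  | collapse {L : Set (Finset X)} {τ : Finset X} {x : X} (hL : MorseBuilt n L) (hτ : τ ∉ L)
      (hx : x ∉ τ) (h : ∀ ρ ⊆ insert x τ, ρ ≠ τ → ρ ≠ insert x τ → ρ ∈ L) :
      MorseBuilt n (L ∪ {τ, insert x τ})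
  | cell {L : Set (Finset X)} {σ : Finset X} (hL : MorseBuilt n L) (hσ : σ ∉ L)
      (h : ∀ ρ ⊂ σ, ρ ∈ L) (hn : n + 2 ≤ #σ) : MorseBuilt n (insert σ L)

theorem MorseBuilt.mono {m n : ℤ} (hmn : m ≤ n) {F : Set (Finset X)} (h : MorseBuilt n F) :
    MorseBuilt m F := by
  induction h with
  | empty => exact .empty
  | collapse _ hτ hx h ih => exact .collapse ih hτ hx h
  | cell _ hσ h hn ih => exact .cell ih hσ h (by omega)

theorem MorseBuilt.mem_of_subset {n : ℤ} {F : Set (Finset X)} (h : MorseBuilt n F) :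
    ∀ {σ ρ : Finset X}, σ ∈ F → ρ ⊆ σ → ρ ∈ F := by
  induction h with
  | empty => simp
  | @collapse L τ x _ hτ hx h ih =>
    intro σ ρ hσ hρ
    by_cases h1 : ρ = τ
    · simp [h1]
    by_cases h2 : ρ = insert x τ
    · simp [h2]
    rcases hσ with hσ | rfl | rfl
    · exact Or.inl (ih hσ hρ)
    · exact Or.inl (h _ (hρ.trans (subset_insert _ _)) h1 h2)
    · exact Or.inl (h _ hρ h1 h2)
  | @cell L σ₀ _ hσ₀ h hn ih =>
    intro σ ρ hσ hρ
    rcases hσ with rfl | hσ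
    · rcases hρ.eq_or_ssubset with rfl | h1
      · exact Or.inl rfl
      · exact Or.inr (h _ h1)
    · exact Or.inr (ih hσ hρ)

/-- A cone collapses to the void family by pairing each face `τ` avoiding the apex with `insert x
τ`. A maximal such `τ` is free, so its pair can be the last one added. -/
theorem MorseBuilt.of_cone [Finite X] (n : ℤ) (x : X) (F : Set (Finset X))
    (hF : ∀ σ ∈ F, ∀ ρ ⊆ σ, ρ ∈ F) (hx : ∀ σ ∈ F, insert x σ ∈ F) : MorseBuilt n F := by
  induction hN : F.ncard using Nat.strong_induction_on generalizing F with
  | _ N ih =>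
  rcases F.eq_empty_or_nonempty with rfl | ⟨σ₀, hσ₀⟩
  · exact .empty
  obtain ⟨τ, hτ⟩ := ({σ ∈ F | x ∉ σ}).toFinite.exists_maximal
    ⟨∅, hF _ hσ₀ _ (empty_subset _), notMem_empty x⟩
  obtain ⟨⟨hτF, hxτ⟩, hmax⟩ := hτ
  have key : ∀ ρ ∈ F, τ ⊆ ρ → ρ = τ ∨ ρ = insert x τ := by
    intro ρ hρ hτρ
    by_cases hxρ : x ∈ ρ
    · right
      have h1 : ρ.erase x ≤ τ := hmax ⟨hF _ hρ _ (erase_subset _ _), notMem_erase _ _⟩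
        (fun y hy => mem_erase.2 ⟨fun h => hxτ (h ▸ hy), hτρ hy⟩)
      refine subset_antisymm (fun y hy => ?_) (insert_subset hxρ hτρ)
      by_cases hyx : y = x
      · simp [hyx]
      · exact mem_insert_of_mem (h1 (mem_erase.2 ⟨hyx, hy⟩))
    · exact Or.inl (subset_antisymm (hmax ⟨hρ, hxρ⟩ hτρ) hτρ)
  have hL : MorseBuilt n (F \ {τ, insert x τ}) := by
    refine ih _ ?_ _ ?_ ?_ rfl
    · rw [← hN]
      exact Set.ncard_lt_ncard ⟨Set.sdiff_subset, fun h => (h hτF).2 (Or.inl rfl)⟩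
        F.toFinite
    · rintro σ ⟨hσ, hσ'⟩ ρ hρ
      refine ⟨hF _ hσ _ hρ, ?_⟩
      rintro (rfl | rfl)
      · exact hσ' (key _ hσ hρ)
      · exact hσ' (key _ hσ ((subset_insert _ _).trans hρ))
    · rintro σ ⟨hσ, hσ'⟩
      refine ⟨hx _ hσ, ?_⟩
      rintro (h | h)
      · exact hxτ (h ▸ mem_insert_self _ _)
      · apply hσ'
        refine key _ hσ fun y hy => ?_
        have : y ∈ insert x σ := h ▸ mem_insert_of_mem hy
        exact (mem_insert.1 this).resolve_left fun h => hxτ (h ▸ hy)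
  have := MorseBuilt.collapse hL (τ := τ) (x := x) (fun h => h.2 (Or.inl rfl)) hxτ
    (fun ρ hρ h1 h2 => ⟨hF _ (hx _ hτF) _ hρ, by simp [h1, h2]⟩)
  rwa [Set.sdiff_union_of_subset] at this
  rintro ρ (rfl | rfl)
  exacts [hτF, hx _ hτF]

/-- Each step building `L` is replayed with `x` inserted. Cells gain one element, which accounts for
`n - 1`; the faces without `x` are already in `D`. -/
theorem MorseBuilt.union_insert {n : ℤ} {x : X} {D L : Set (Finset X)} (hD : MorseBuilt n D)
    (hxD : ∀ σ ∈ D, x ∉ σ) (hL : MorseBuilt (n - 1) L) (hLD : L ⊆ D) :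
    MorseBuilt n (D ∪ insert x '' L) := by
  have hins : ∀ {σ τ : Finset X}, x ∉ σ → x ∉ τ → insert x σ = insert x τ → σ = τ := by
    intro σ τ hσ hτ h
    rw [← erase_insert hσ, h, erase_insert hτ]
  induction hL with
  | empty => simpa using hD
  | @collapse L τ y hL hτ hy h ih =>
    have hLD' : L ⊆ D := fun σ hσ => hLD (Or.inl hσ)
    have hτD : τ ∈ D := hLD (by simp)
    have hyD : insert y τ ∈ D := hLD (by simp)
    have hyx : y ≠ x := fun e => hxD _ hyD (by simp [e])
    have := MorseBuilt.collapse (ih hLD') (τ := insert x τ) (x := y) ?_ (by simp [hyx, hy]) ?_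
    · convert this using 1
      rw [Set.image_union, Set.image_pair, Finset.insert_comm x y, Set.union_assoc]
    · rintro (h1 | ⟨σ, hσ, h1⟩)
      · exact hxD _ h1 (by simp)
      · exact hτ (hins (hxD _ (hLD' hσ)) (hxD _ hτD) h1 ▸ hσ)
    · intro ρ hρ h1 h2
      rw [Finset.insert_comm] at hρ h2
      by_cases hxρ : x ∈ ρ
      · refine Or.inr ⟨ρ.erase x, h _ ?_ ?_ ?_, insert_erase hxρ⟩
        · exact subset_insert_iff.1 hρ
        · exact fun e => h1 (by rw [← e, insert_erase hxρ])
        · exact fun e => h2 (by rw [← e, insert_erase hxρ])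
      · exact Or.inl (hD.mem_of_subset hyD ((subset_insert_iff_of_notMem hxρ).1 hρ))
  | @cell L σ hL hσ h hn ih =>
    have hLD' : L ⊆ D := fun σ hσ => hLD (Or.inr hσ)
    have hσD : σ ∈ D := hLD (by simp)
    have := MorseBuilt.cell (ih hLD') (σ := insert x σ) ?_ ?_ ?_
    · convert this using 1
      rw [Set.image_insert_eq, Set.union_insert]
    · rintro (h1 | ⟨σ', hσ', h1⟩)
      · exact hxD _ h1 (by simp)
      · exact hσ (hins (hxD _ (hLD' hσ')) (hxD _ hσD) h1 ▸ hσ')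
    · intro ρ hρ
      by_cases hxρ : x ∈ ρ
      · refine Or.inr ⟨ρ.erase x, h _ ?_, insert_erase hxρ⟩
        refine (subset_insert_iff.1 hρ.1).ssubset_of_ne fun e => hρ.ne ?_
        rw [← e, insert_erase hxρ]
      · exact Or.inl (hD.mem_of_subset hσD ((subset_insert_iff_of_notMem hxρ).1 hρ.1))
    · rw [card_insert_of_notMem (hxD _ hσD)]
      push_cast
      omega

theorem MorseBuilt.of_deletion_link {n : ℤ} (x : X) {F : Set (Finset X)}
    (hF : ∀ σ ∈ F, ∀ ρ ⊆ σ, ρ ∈ F) (hdel : MorseBuilt n {σ ∈ F | x ∉ σ})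
    (hlink : MorseBuilt (n - 1) {σ | x ∉ σ ∧ insert x σ ∈ F}) : MorseBuilt n F := by
  have := hdel.union_insert (fun σ hσ => hσ.2) hlink
    (fun σ hσ => ⟨hF _ hσ.2 _ (subset_insert _ _), hσ.1⟩)
  convert this using 1
  ext σ
  constructor
  · intro hσ
    by_cases hx : x ∈ σ
    · exact Or.inr ⟨σ.erase x, ⟨notMem_erase _ _, by rwa [insert_erase hx]⟩, insert_erase hx⟩
    · exact Or.inl ⟨hσ, hx⟩
  · rintro (h | ⟨τ, h, rfl⟩)
    exacts [h.1, h.2]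

end MorseBuilt

/-! ### Matroids: deletion, contraction, coloops -/

section IndepFamily

variable {E : Type*} [DecidableEq E]

/-- The axioms for the independent sets of a matroid. -/
structure IsIndepFamily (Ind : Finset E → Prop) : Prop where
  empty : Ind ∅
  subset : ∀ {I J}, Ind J → I ⊆ J → Ind I
  aug : ∀ {I J}, Ind I → Ind J → #I < #J → ∃ e ∈ J, e ∉ I ∧ Ind (insert e I)

/-- Contraction of an element. -/
def contr (Ind : Finset E → Prop) (e : E) (T : Finset E) : Prop := e ∉ T ∧ Ind (insert e T)

/-- Deletion of an element. -/
def del (Ind : Finset E → Prop) (e : E) (T : Finset E) : Prop := e ∉ T ∧ Ind T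

variable {Ind : Finset E → Prop}

theorem IsIndepFamily.exists_superset (h : IsIndepFamily Ind) {I J : Finset E} (hI : Ind I)
    (hJ : Ind J) (hIJ : #I ≤ #J) : ∃ I', I ⊆ I' ∧ Ind I' ∧ #I' = #J := by
  induction hd : #J - #I generalizing I with
  | zero => exact ⟨I, subset_rfl, hI, by omega⟩
  | succ d ih =>
    obtain ⟨e, -, heI, he⟩ := h.aug hI hJ (by omega)
    have hc := card_insert_of_notMem heI
    obtain ⟨I', h1, h2, h3⟩ := ih he (by omega) (by omega)
    exact ⟨I', (subset_insert _ _).trans h1, h2, h3⟩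

theorem IsIndepFamily.contr (h : IsIndepFamily Ind) {e : E} (he : Ind {e}) :
    IsIndepFamily (contr Ind e) where
  empty := ⟨notMem_empty _, he⟩
  subset := fun hJ hIJ => ⟨fun h' => hJ.1 (hIJ h'), h.subset hJ.2 (insert_subset_insert _ hIJ)⟩
  aug := by
    rintro I J ⟨hI, hI'⟩ ⟨hJ, hJ'⟩ hlt
    obtain ⟨x, hxJ, hxI, hx⟩ := h.aug hI' hJ' (by
      rw [card_insert_of_notMem hI, card_insert_of_notMem hJ]; omega)
    rw [mem_insert, not_or] at hxI
    refine ⟨x, (mem_insert.1 hxJ).resolve_left hxI.1, hxI.2, ?_, by rwa [Finset.insert_comm]⟩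
    simp [hI, Ne.symm hxI.1]

theorem IsIndepFamily.del (h : IsIndepFamily Ind) (e : E) : IsIndepFamily (del Ind e) where
  empty := ⟨notMem_empty _, h.empty⟩
  subset := fun hJ hIJ => ⟨fun h' => hJ.1 (hIJ h'), h.subset hJ.2 hIJ⟩
  aug := by
    rintro I J ⟨hI, hI'⟩ ⟨hJ, hJ'⟩ hlt
    obtain ⟨x, hxJ, hxI, hx⟩ := h.aug hI' hJ' hlt
    refine ⟨x, hxJ, hxI, ?_, hx⟩
    rw [mem_insert, not_or]
    exact ⟨fun e => hJ (e ▸ hxJ), hI⟩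

theorem IsIndepFamily.exists_contr_card (h : IsIndepFamily Ind) {e : E} (he : Ind {e})
    {I : Finset E} (hI : Ind I) : ∃ I', _root_.contr Ind e I' ∧ #I' = #I - 1 := by
  rcases Nat.eq_zero_or_pos #I with h0 | h0
  · exact ⟨∅, ⟨notMem_empty _, he⟩, by simp [h0]⟩
  obtain ⟨I', h1, h2, h3⟩ := h.exists_superset he hI (by simpa using h0)
  have heI' : e ∈ I' := h1 (by simp)
  exact ⟨I'.erase e, ⟨notMem_erase _ _, by rwa [insert_erase heI']⟩, by
    rw [card_erase_of_mem heI', h3]⟩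

/-- An independent set no larger than `I` extends to one of size `#I`, which contains `e`; a larger
one has a subset of that size, so it contains `e` already. Hence `e` behaves like a coloop and
yields a cone. -/
theorem IsIndepFamily.insert_of_forall_mem (h : IsIndepFamily Ind) {e : E} {I : Finset E}
    (hI : Ind I) (he : ∀ J, Ind J → #J = #I → e ∈ J) {T : Finset E} (hT : Ind T) :
    Ind (insert e T) := by
  by_cases heT : e ∈ T
  · rwa [insert_eq_of_mem heT]
  rcases le_total #T #I with hle | hle
  · obtain ⟨T', h1, h2, h3⟩ := h.exists_superset hT hI hle
    exact h.subset h2 (insert_subset (he _ h2 h3) h1)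
  · obtain ⟨T', h1, h2⟩ := exists_subset_card_eq hle
    exact absurd (h1 (he _ (h.subset hT h1) h2)) heT

end IndepFamily

/-! ### Complexes of fillings of independent slot sets -/

section FillingFamily

variable {ρ V κ : Type*} [DecidableEq ρ] [DecidableEq κ]

/-- The position of a vertex: its row and its color. -/
def slot (c : V → κ) (p : ρ × V) : ρ × κ := (p.1, c p.2)

/-- The sets of vertices from `A` that fill the positions of an independent set, each position
once and each element of `V` being used at most once. -/
def fillings (c : V → κ) (Ind : Finset (ρ × κ) → Prop) (A : Set (ρ × V)) :
    Set (Finset (ρ × V)) :=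
  {σ | (∀ p ∈ σ, p ∈ A) ∧ (∀ p ∈ σ, ∀ q ∈ σ, p.2 = q.2 → p = q) ∧
    (∀ p ∈ σ, ∀ q ∈ σ, slot c p = slot c q → p = q) ∧ Ind (σ.image (slot c))}

variable {c : V → κ} {Ind : Finset (ρ × κ) → Prop} {A : Set (ρ × V)}

theorem fillings_subset (h : IsIndepFamily Ind) :
    ∀ σ ∈ fillings c Ind A, ∀ τ ⊆ σ, τ ∈ fillings c Ind A :=
  fun _ hσ _ hτ => ⟨fun p hp => hσ.1 p (hτ hp), fun p hp q hq => hσ.2.1 p (hτ hp) q (hτ hq),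
    fun p hp q hq => hσ.2.2.1 p (hτ hp) q (hτ hq), h.subset hσ.2.2.2 (image_subset_image hτ)⟩

/-- Placements in a loop of the matroid never occur. After contracting `e`, the admissible set may
therefore be changed freely on slot `e`. -/
theorem fillings_congr (h : IsIndepFamily Ind) {A' : Set (ρ × V)}
    (hA : ∀ p, Ind {slot c p} → (p ∈ A ↔ p ∈ A')) : fillings c Ind A = fillings c Ind A' := by
  ext σ
  have : ∀ (_ : Ind (σ.image (slot c))), ∀ p ∈ σ, (p ∈ A ↔ p ∈ A') := fun hσ p hp =>
    hA p (h.subset hσ (by simpa using ⟨_, _, hp, rfl⟩))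
  constructor
  · rintro ⟨h1, h2, h3, h4⟩
    exact ⟨fun p hp => (this h4 p hp).1 (h1 p hp), h2, h3, h4⟩
  · rintro ⟨h1, h2, h3, h4⟩
    exact ⟨fun p hp => (this h4 p hp).2 (h1 p hp), h2, h3, h4⟩

theorem fillings_deletion (x : ρ × V) :
    {σ ∈ fillings c Ind A | x ∉ σ} = fillings c Ind (A \ {x}) := by
  ext σ
  constructor
  · rintro ⟨⟨h1, h2⟩, h3⟩
    exact ⟨fun p hp => ⟨h1 p hp, fun e => h3 (e ▸ hp)⟩, h2⟩
  · rintro ⟨h1, h2⟩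
    exact ⟨⟨fun p hp => (h1 p hp).1, h2⟩, fun e => (h1 x e).2 rfl⟩

theorem fillings_eq_empty (h : IsIndepFamily Ind) {e : ρ × κ} (he : ¬ Ind {e}) :
    fillings c (contr Ind e) A = ∅ := by
  refine Set.eq_empty_of_forall_notMem fun σ hσ => he (h.subset hσ.2.2.2.2 (by simp))

variable [DecidableEq V]

theorem fillings_link {x : ρ × V} (hx : x ∈ A) :
    {σ | x ∉ σ ∧ insert x σ ∈ fillings c Ind A} =
      fillings c (contr Ind (slot c x)) {p ∈ A | p.2 ≠ x.2} := by
  ext σ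
  constructor
  · rintro ⟨hxσ, h1, h2, h3, h4⟩
    refine ⟨fun p hp => ⟨h1 p (mem_insert_of_mem hp), fun e => hxσ ?_⟩,
      fun p hp q hq => h2 p (mem_insert_of_mem hp) q (mem_insert_of_mem hq),
      fun p hp q hq => h3 p (mem_insert_of_mem hp) q (mem_insert_of_mem hq), fun e => hxσ ?_,
      by rwa [image_insert] at h4⟩
    · rwa [← h2 p (mem_insert_of_mem hp) x (mem_insert_self _ _) e]
    · obtain ⟨p, hp, e⟩ := mem_image.1 e
      rwa [← h3 p (mem_insert_of_mem hp) x (mem_insert_self _ _) e]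
  · rintro ⟨h1, h2, h3, h4, h5⟩
    have h4' : ∀ p ∈ σ, slot c p ≠ slot c x := fun p hp e => h4 (mem_image.2 ⟨p, hp, e⟩)
    refine ⟨fun e => (h1 x e).2 rfl, ?_, ?_, ?_, by rwa [image_insert]⟩
    · intro p hp
      rcases mem_insert.1 hp with rfl | hp
      exacts [hx, (h1 p hp).1]
    · intro p hp q hq e
      rcases mem_insert.1 hp with hp | hp <;> rcases mem_insert.1 hq with hq | hq
      exacts [hp.trans hq.symm, absurd (hp ▸ e.symm) (h1 q hq).2, absurd (hq ▸ e) (h1 p hp).2,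
        h2 p hp q hq e]
    · intro p hp q hq e
      rcases mem_insert.1 hp with hp | hp <;> rcases mem_insert.1 hq with hq | hq
      exacts [hp.trans hq.symm, absurd (hp ▸ e.symm) (h4' q hq), absurd (hq ▸ e) (h4' p hp),
        h3 p hp q hq e]

/-- The vertices of `D` are put back one at a time; `A'` is the set of placements admissible at the
moment when `x` is put back. -/
theorem MorseBuilt.fillings_of_diff {n : ℤ} (h : IsIndepFamily Ind) (D : Finset (ρ × V))
    (hdel : MorseBuilt n (fillings c Ind (A \ D)))
    (hlink : ∀ x ∈ D, x ∈ A → ∀ A' ⊆ A, A \ D ⊆ A' →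
      MorseBuilt (n - 1) (fillings c (contr Ind (slot c x)) {p ∈ A' | p.2 ≠ x.2})) :
    MorseBuilt n (fillings c Ind A) := by
  induction D using Finset.induction_on generalizing A with
  | empty => simpa using hdel
  | @insert x D hx ih =>
    by_cases hxA : x ∈ A
    · refine MorseBuilt.of_deletion_link x (fillings_subset h) ?_ ?_
      · rw [fillings_deletion]
        refine ih ?_ fun y hy hyA A' hA' hDA' => ?_
        · convert hdel using 2
          rw [Set.sdiff_sdiff, coe_insert, Set.insert_eq]
        · refine hlink y (mem_insert_of_mem hy) hyA.1 A' (hA'.trans Set.sdiff_subset) ?_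
          convert hDA' using 1
          rw [Set.sdiff_sdiff, coe_insert, Set.insert_eq]
      · rw [fillings_link hxA]
        exact hlink x (mem_insert_self _ _) hxA A subset_rfl Set.sdiff_subset
    · have e : A \ (insert x D : Finset (ρ × V)) = A \ D := by
        ext y
        simp only [coe_insert, Set.mem_sdiff, Set.mem_insert_iff, not_or]
        exact ⟨fun hy => ⟨hy.1, hy.2.2⟩, fun hy => ⟨hy.1, fun e => hxA (e ▸ hy.1), hy.2⟩⟩
      rw [e] at hdel hlink
      exact ih hdel fun y hy => hlink y (mem_insert_of_mem hy)

theorem morseBuilt_fillings [Finite ρ] [Finite V] (h : IsIndepFamily Ind) (S : Finset (ρ × κ))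
    (hS : ∀ T, Ind T → T ⊆ S) {I : Finset (ρ × κ)} (hI : Ind I) (W : Finset V)
    (hW : ∀ j, 2 * #{e ∈ S | e.2 = j} - 1 ≤ #{v ∈ W | c v = j}) :
    MorseBuilt (#I - 2 : ℤ) (fillings c Ind {p | p.2 ∈ W}) := by
  have := Fintype.ofFinite ρ
  have := Fintype.ofFinite V
  induction hN : #S generalizing S Ind I W with
  | zero =>
    obtain rfl := card_eq_zero.1 hN
    obtain rfl := subset_empty.1 (hS I hI)
    have : fillings c Ind {p : ρ × V | p.2 ∈ W} = insert ∅ ∅ := by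
      ext σ
      simp only [insert_empty_eq, Set.mem_singleton_iff]
      constructor
      · rintro ⟨-, -, -, h4⟩
        simpa using hS _ h4
      · rintro rfl
        exact ⟨by simp, by simp, by simp, by simpa using hI⟩
    rw [this]
    -- Here `#I = 0`, so the bound `n + 2` is zero and the empty face itself counts as a cell.
    exact .cell .empty (by simp) (by simp) (by simp)
  | succ N ih =>
    -- the induction hypothesis, applied to a contraction
    have link : ∀ e ∈ S, ∀ W' ⊆ W, (∀ v ∈ W, v ∉ W' → c v = e.2) → #W ≤ #W' + 2 →
        ∀ A : Set (ρ × V), (∀ p, slot c p ≠ e → (p ∈ A ↔ p.2 ∈ W')) →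
        MorseBuilt (#I - 2 - 1 : ℤ) (fillings c (contr Ind e) A) := by
      intro e heS W' hW' hcol hcard A hA
      by_cases he : Ind {e}
      · obtain ⟨I', hI', hcI'⟩ := h.exists_contr_card he hI
        rw [fillings_congr (h.contr he) (A' := {p | p.2 ∈ W'})
          fun p hp => hA p fun e' => hp.1 (by simp [e'])]
        refine (ih (h.contr he) (S.erase e) (fun T hT => ?_) hI' W' (fun j => ?_) ?_).mono ?_
        · exact subset_erase.2 ⟨(subset_insert _ _).trans (hS _ hT.2), hT.1⟩
        · have hWj := hW j
          by_cases hj : e.2 = j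
          -- In the column of `e` one slot is lost, so the required number of vertices drops by two,
          -- covering the at most two vertices dropped from `W`.
          · have h1 : #{e' ∈ S.erase e | e'.2 = j} + 1 = #{e' ∈ S | e'.2 = j} := by
              rw [filter_erase, card_erase_add_one (by simp [heS, hj])]
            have h2 : #{v ∈ W | c v = j} ≤ #{v ∈ W' | c v = j} + 2 := by
              have h3 := card_sdiff_add_card_eq_card hW'
              have h4 : {v ∈ W | c v = j} ⊆ {v ∈ W' | c v = j} ∪ (W \ W') := by
                intro v hv
                simp only [mem_filter, mem_union, mem_sdiff] at hv ⊢
                tauto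
              have h5 := (card_le_card h4).trans (card_union_le _ _)
              omega
            omega
          · have h1 : {e' ∈ S.erase e | e'.2 = j} ⊆ {e' ∈ S | e'.2 = j} :=
              filter_subset_filter _ (erase_subset _ _)
            have h2 : {v ∈ W | c v = j} ⊆ {v ∈ W' | c v = j} := by
              intro v hv
              simp only [mem_filter] at hv ⊢
              exact ⟨by_contra fun h' => hj (by rw [← hcol v hv.1 h', hv.2]), hv.2⟩
            have h3 := card_le_card h1
            have h4 := card_le_card h2
            omega
        · rw [card_erase_of_mem heS, hN]; rfl
        · omega
      · rw [fillings_eq_empty h he]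
        exact .empty
    -- Contracting a loop gives the void family, without even the empty face: such a vertex is in no
    -- simplex and contributes nothing.
    have loop : ∀ e ∉ S, ∀ A : Set (ρ × V), fillings c (contr Ind e) A = ∅ := fun e he A =>
      fillings_eq_empty h fun h' => he (hS _ h' (by simp))
    obtain ⟨e, heS⟩ : S.Nonempty := card_pos.1 (by omega)
    by_cases hcol : ∃ J, Ind J ∧ #J = #I ∧ e ∉ J
    · obtain ⟨J, hJ, hJI, heJ⟩ := hcol
      refine MorseBuilt.fillings_of_diff h {p | slot c p = e} ?_ ?_
      · have := ih (h.del e) (S.erase e) (fun T hT => subset_erase.2 ⟨hS _ hT.2, hT.1⟩)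
          ⟨heJ, hJ⟩ W (fun j => ?_) (by rw [card_erase_of_mem heS, hN]; rfl)
        · rw [hJI] at this
          convert this using 1
          ext σ
          constructor
          · rintro ⟨h1, h2, h3, h4⟩
            refine ⟨fun p hp => (h1 p hp).1, h2, h3, fun h' => ?_, h4⟩
            obtain ⟨p, hp, h'⟩ := mem_image.1 h'
            exact (h1 p hp).2 (by simpa using h')
          · rintro ⟨h1, h2, h3, h4, h5⟩
            refine ⟨fun p hp => ⟨h1 p hp, fun h' => h4 (mem_image.2 ⟨p, hp, ?_⟩)⟩, h2, h3, h5⟩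
            simpa using h'
        · have := card_le_card (filter_subset_filter (fun e' => e'.2 = j) (erase_subset e S))
          have := hW j
          omega
      · intro x hxe hxW A' hA' hDA'
        have hxe : slot c x = e := by simpa using hxe
        rw [hxe]
        refine link e heS (W.erase x.2) (erase_subset _ _) ?_ ?_ _ ?_
        · intro v hv hv'
          obtain rfl : v = x.2 := by simpa [hv] using hv'
          rw [← hxe, slot]
        · have := pred_card_le_card_erase (s := W) (a := x.2)
          omega
        · intro p hp
          simp only [Set.mem_ofPred_eq, mem_erase]
          refine ⟨fun h' => ⟨h'.2, hA' h'.1⟩, fun h' => ⟨hDA' ⟨h'.2, ?_⟩, h'.1⟩⟩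
          simpa using hp
    · push Not at hcol
      obtain ⟨i, j⟩ := e
      obtain ⟨v₀, hv₀⟩ : ({v ∈ W | c v = j}).Nonempty := by
        refine card_pos.1 (lt_of_lt_of_le ?_ (hW j))
        have : 0 < #{e ∈ S | e.2 = j} := card_pos.2 ⟨(i, j), by simp [heS]⟩
        omega
      obtain ⟨hv₀W, hv₀j⟩ := mem_filter.1 hv₀
      -- The outer removal takes out `v₀` in rows other than `i`; the inner one takes out the
      -- fillers of `(i, j)` other than `v₀`. The cone with apex `(i, v₀)` is left.
      refine MorseBuilt.fillings_of_diff h {p | p.2 = v₀ ∧ p.1 ≠ i} ?_ ?_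
      · refine MorseBuilt.fillings_of_diff h {p | slot c p = (i, j) ∧ p.2 ≠ v₀} ?_ ?_
        · refine MorseBuilt.of_cone _ (i, v₀) _ (fillings_subset h) ?_
          rintro σ ⟨h1, h2, h3, h4⟩
          have hcolv : ∀ p ∈ σ, p.2 = v₀ → p = (i, v₀) := by
            intro p hp e
            have := (h1 p hp).1.2
            simp only [coe_filter, mem_univ, true_and, Set.mem_ofPred_eq, not_and, not_not] at this
            exact Prod.ext (this e) e
          have hslot : ∀ p ∈ σ, slot c p = (i, j) → p = (i, v₀) := by
            intro p hp e
            have := (h1 p hp).2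
            simp only [coe_filter, mem_univ, true_and, Set.mem_ofPred_eq, not_and, not_not] at this
            exact hcolv p hp (this e)
          have hslot₀ : slot c (i, v₀) = (i, j) := by simp [slot, hv₀j]
          refine ⟨?_, ?_, ?_, ?_⟩
          · intro p hp
            rcases mem_insert.1 hp with rfl | hp
            · simp [hv₀W]
            · exact h1 p hp
          · intro p hp q hq e
            rcases mem_insert.1 hp with rfl | hp <;> rcases mem_insert.1 hq with rfl | hq
            exacts [rfl, (hcolv q hq e.symm).symm, hcolv p hp e, h2 p hp q hq e]
          · intro p hp q hq e
            rcases mem_insert.1 hp with rfl | hp <;> rcases mem_insert.1 hq with rfl | hq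
            exacts [rfl, (hslot q hq (e.symm.trans hslot₀)).symm, hslot p hp (e.trans hslot₀),
              h3 p hp q hq e]
          · rw [image_insert, hslot₀]
            exact h.insert_of_forall_mem hI hcol h4
        · intro x hx hxW A' hA' hDA'
          obtain ⟨hxe, hxv⟩ : slot c x = (i, j) ∧ x.2 ≠ v₀ := by simpa using hx
          have hxW : x.2 ∈ W := hxW.1
          rw [hxe]
          -- Any placement of `v₀` still admissible lies in the contracted slot, so `v₀` is lost
          -- along with `x.2`. This is the case that uses both spare vertices.
          refine link _ heS ((W.erase v₀).erase x.2)
            ((erase_subset _ _).trans (erase_subset _ _)) ?_ ?_ _ ?_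
          · intro v hv hv'
            simp only [mem_erase, hv, and_true, not_and, not_not] at hv'
            by_cases e : v = x.2
            · rw [e]; exact (Prod.ext_iff.1 hxe).2
            · rw [hv' e]; exact hv₀j
          · rw [card_erase_of_mem (by simp [hxv, hxW]), card_erase_of_mem hv₀W]
            omega
          · intro p hp
            simp only [Set.mem_ofPred_eq, mem_erase]
            constructor
            · rintro ⟨hpA, hpx⟩
              have := hA' hpA
              simp only [coe_filter, mem_univ, true_and, Set.mem_ofPred_eq, not_and, not_not,
                Set.mem_sdiff] at this
              refine ⟨hpx, fun e => hp ?_, this.1⟩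
              rw [slot, this.2 e, e, hv₀j]
            · rintro ⟨hpx, hpv, hpW⟩
              refine ⟨hDA' ?_, hpx⟩
              simp [hpW, hpv, hp]
      · intro x hx hxW A' hA' hDA'
        obtain ⟨hxv, hxi⟩ : x.2 = v₀ ∧ x.1 ≠ i := by simpa using hx
        by_cases hxS : slot c x ∈ S
        · refine link _ hxS (W.erase v₀) (erase_subset _ _) ?_ ?_ _ ?_
          · intro v hv hv'
            obtain rfl : v = v₀ := by simpa [hv] using hv'
            rw [slot, hxv]
          · rw [card_erase_of_mem hv₀W]
            omega
          · intro p hp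
            simp only [Set.mem_ofPred_eq, mem_erase, hxv]
            refine ⟨fun h' => ⟨h'.2, hA' h'.1⟩, fun h' => ⟨hDA' ⟨h'.2, ?_⟩, h'.1⟩⟩
            simp [h'.1]
        · rw [loop _ hxS]
          exact .empty

end FillingFamily

/-! ### Extending maps from spheres to balls -/

section Sphere

variable {X : Type*} [TopologicalSpace X] {j : ℕ}

/-- The map extends from the unit sphere to the closed unit ball. -/
def ExtendsToBall (f : C(Metric.sphere (0 : EuclideanSpace ℝ (Fin j)) 1, X)) : Prop :=
  ∃ g : C(Metric.closedBall (0 : EuclideanSpace ℝ (Fin j)) 1, X),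
    ∀ x : Metric.sphere (0 : EuclideanSpace ℝ (Fin j)) 1,
      g ⟨x.1, Metric.sphere_subset_closedBall x.2⟩ = f x

/-- On the ball of radius `1/2` use the given extension, rescaled; on the outer shell run the
homotopy along the radius. -/
theorem ExtendsToBall.of_homotopic
    {f f' : C(Metric.sphere (0 : EuclideanSpace ℝ (Fin j)) 1, X)} (hf : f.Homotopic f')
    (h : ExtendsToBall f') : ExtendsToBall f := by
  classical
  obtain ⟨H⟩ := hf
  obtain ⟨g', hg'⟩ := h
  have hin : ∀ y : EuclideanSpace ℝ (Fin j),
      (max 1 ‖y‖)⁻¹ • y ∈ Metric.closedBall (0 : EuclideanSpace ℝ (Fin j)) 1 := by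
    intro y
    have h0 : 0 < max 1 ‖y‖ := lt_max_of_lt_left one_pos
    rw [mem_closedBall_zero_iff, norm_smul, norm_inv, Real.norm_of_nonneg h0.le,
      inv_mul_le_iff₀ h0, mul_one]
    exact le_max_right _ _
  have hdir : ∀ y : EuclideanSpace ℝ (Fin j), y ≠ 0 →
      ‖y‖⁻¹ • y ∈ Metric.sphere (0 : EuclideanSpace ℝ (Fin j)) 1 := by
    intro y hy
    rw [mem_sphere_zero_iff_norm, norm_smul, norm_inv, norm_norm,
      inv_mul_cancel₀ (norm_ne_zero_iff.2 hy)]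
  let G₁ : Metric.closedBall (0 : EuclideanSpace ℝ (Fin j)) 1 → X := fun x =>
    g' ⟨_, hin ((2 : ℝ) • x.1)⟩
  let t : Metric.closedBall (0 : EuclideanSpace ℝ (Fin j)) 1 → unitInterval := fun x =>
    Set.projIcc 0 1 zero_le_one (2 - 2 * ‖x.1‖)
  let G₂ : Metric.closedBall (0 : EuclideanSpace ℝ (Fin j)) 1 → X := fun x =>
    if hx : x.1 ≠ 0 then H (t x, ⟨_, hdir x.1 hx⟩) else G₁ x
  have ht : Continuous t := continuous_projIcc.comp (by fun_prop)
  have hG₁ : Continuous G₁ := by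
    have hc : Continuous fun x : Metric.closedBall (0 : EuclideanSpace ℝ (Fin j)) 1 =>
        (max 1 ‖(2 : ℝ) • x.1‖)⁻¹ • (2 : ℝ) • x.1 := by
      have hi : Continuous fun x : Metric.closedBall (0 : EuclideanSpace ℝ (Fin j)) 1 =>
          (max 1 ‖(2 : ℝ) • x.1‖)⁻¹ :=
        Continuous.inv₀ (by fun_prop) fun x => (lt_max_of_lt_left one_pos).ne'
      exact hi.smul (by fun_prop)
    exact g'.continuous.comp (hc.subtype_mk _)
  have hG₂ : ContinuousOn G₂ {x | (1 / 2 : ℝ) ≤ ‖x.1‖} := by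
    have hne : ∀ x : {x : Metric.closedBall (0 : EuclideanSpace ℝ (Fin j)) 1 | (1 / 2 : ℝ) ≤ ‖x.1‖},
        x.1.1 ≠ 0 := by
      intro x hx
      have := x.2
      rw [Set.mem_ofPred_eq, hx, norm_zero] at this
      norm_num at this
    rw [continuousOn_iff_continuous_domRestrict]
    have e : Set.domRestrict {x : Metric.closedBall (0 : EuclideanSpace ℝ (Fin j)) 1 |
        (1 / 2 : ℝ) ≤ ‖x.1‖} G₂ =
        fun x => H (t x.1, ⟨_, hdir x.1.1 (hne x)⟩) := by
      funext x
      exact dif_pos (hne x)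
    rw [e]
    have hc : Continuous fun x : {x : Metric.closedBall (0 : EuclideanSpace ℝ (Fin j)) 1 |
        (1 / 2 : ℝ) ≤ ‖x.1‖} => ‖x.1.1‖⁻¹ • x.1.1 := by
      have hi : Continuous fun x : {x : Metric.closedBall (0 : EuclideanSpace ℝ (Fin j)) 1 |
          (1 / 2 : ℝ) ≤ ‖x.1‖} => ‖x.1.1‖⁻¹ :=
        Continuous.inv₀ (by fun_prop) fun x => norm_ne_zero_iff.2 (hne x)
      exact hi.smul (by fun_prop)
    exact H.continuous.comp ((ht.comp continuous_subtype_val).prodMk (hc.subtype_mk _))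
  refine ⟨⟨fun x => if ‖x.1‖ ≤ 1 / 2 then G₁ x else G₂ x,
    continuous_if_le (by fun_prop) continuous_const hG₁.continuousOn hG₂ ?_⟩, ?_⟩
  · intro x hx
    have hx0 : x.1 ≠ 0 := by
      intro h
      rw [h, norm_zero] at hx
      norm_num at hx
    have h2 : ‖(2 : ℝ) • x.1‖ = 1 := by rw [norm_smul, hx]; norm_num
    have ht1 : t x = 1 := by
      simp only [t, hx]
      exact Set.projIcc_of_right_le _ (by norm_num)
    simp only [G₁, G₂, dif_pos hx0, ht1, ContinuousMap.Homotopy.apply_one]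
    rw [← hg']
    congr 2
    change (max 1 ‖(2 : ℝ) • x.1‖)⁻¹ • (2 : ℝ) • x.1 = ‖x.1‖⁻¹ • x.1
    rw [h2, hx, max_self, inv_one, one_smul]
    norm_num
  · intro x
    have hx : ‖x.1‖ = 1 := mem_sphere_zero_iff_norm.1 x.2
    have hx0 : x.1 ≠ 0 := by
      intro h
      rw [h, norm_zero] at hx
      norm_num at hx
    have ht0 : Set.projIcc (0 : ℝ) 1 zero_le_one (2 - 2 * ‖x.1‖) = 0 := by
      rw [hx]
      exact Set.projIcc_of_le_left _ (by norm_num)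
    simp only [ContinuousMap.coe_mk, G₂, t, dif_pos hx0, ht0, ContinuousMap.Homotopy.apply_zero]
    rw [if_neg (by rw [hx]; norm_num)]
    congr 1
    ext1
    simp [hx]

theorem homotopic_of_forall_mem {Y : Type*} [TopologicalSpace Y] {B : Set Y}
    (f : C(X, B)) (H : unitInterval × X → Y) (hH : Continuous H) (hB : ∀ p, H p ∈ B)
    (h0 : ∀ x, H (0, x) = f x) :
    f.Homotopic ⟨fun x => ⟨H (1, x), hB _⟩, by fun_prop⟩ :=
  ⟨{  toFun := fun p => ⟨H p, hB p⟩
      continuous_toFun := by fun_prop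
      map_zero_left := fun x => Subtype.ext (h0 x)
      map_one_left := fun x => rfl }⟩

theorem ExtendsToBall.of_deformation {A B : Set X} (hAB : A ⊆ B)
    (f : C(Metric.sphere (0 : EuclideanSpace ℝ (Fin j)) 1, B))
    (H : unitInterval × Metric.sphere (0 : EuclideanSpace ℝ (Fin j)) 1 → X) (hH : Continuous H)
    (hB : ∀ p, H p ∈ B) (h0 : ∀ x, H (0, x) = f x) (h1 : ∀ x, H (1, x) ∈ A)
    (hA : ∀ f' : C(Metric.sphere (0 : EuclideanSpace ℝ (Fin j)) 1, A), ExtendsToBall f') :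
    ExtendsToBall f := by
  refine .of_homotopic (homotopic_of_forall_mem f H hH hB h0) ?_
  obtain ⟨g, hg⟩ := hA ⟨fun x => ⟨H (1, x), h1 x⟩, by fun_prop⟩
  refine ⟨⟨fun x => ⟨(g x).1, hAB (g x).2⟩, by fun_prop⟩, fun x => ?_⟩
  ext1
  have := congrArg (fun a : A => (a : X)) (hg x)
  exact this

/-- Stone–Weierstrass, for the algebra of restrictions of `C¹` functions; the coordinates separate
points. -/
theorem exists_contDiff_approx (f : C(Metric.sphere (0 : EuclideanSpace ℝ (Fin j)) 1, ℝ)) {ε : ℝ}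
    (hε : 0 < ε) : ∃ G : EuclideanSpace ℝ (Fin j) → ℝ, ContDiff ℝ 1 G ∧
      ∀ x : Metric.sphere (0 : EuclideanSpace ℝ (Fin j)) 1, |G x - f x| < ε := by
  let A : Subalgebra ℝ C(Metric.sphere (0 : EuclideanSpace ℝ (Fin j)) 1, ℝ) :=
    { carrier := {g | ∃ G : EuclideanSpace ℝ (Fin j) → ℝ, ContDiff ℝ 1 G ∧ ∀ x, G x.1 = g x}
      mul_mem' := by
        rintro a b ⟨G, hG, h⟩ ⟨G', hG', h'⟩
        exact ⟨fun x => G x * G' x, hG.mul hG', fun x => by simp [h, h']⟩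
      add_mem' := by
        rintro a b ⟨G, hG, h⟩ ⟨G', hG', h'⟩
        exact ⟨fun x => G x + G' x, hG.add hG', fun x => by simp [h, h']⟩
      algebraMap_mem' := fun a => ⟨fun _ => a, contDiff_const, fun x => rfl⟩ }
  have hA : A.SeparatesPoints := by
    intro x y hxy
    obtain ⟨i, hi⟩ : ∃ i, x.1 i ≠ y.1 i := by
      by_contra! h
      exact hxy (Subtype.ext (PiLp.ext h))
    refine ⟨fun x => x.1 i, ⟨⟨fun x => x.1 i, by fun_prop⟩, ?_, rfl⟩, hi⟩
    exact ⟨fun x => x i, by fun_prop, fun x => rfl⟩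
  obtain ⟨⟨g, G, hG, h⟩, hg⟩ :=
    ContinuousMap.exists_mem_subalgebra_near_continuous_of_separatesPoints A hA f f.continuous ε hε
  exact ⟨G, hG, fun x => by rw [h]; exact hg x⟩

/-- For `j` below the target dimension the whole range of `G` has dense complement. In equal
dimensions the sphere is a null set, and differentiable maps preserve null sets. -/
theorem dense_compl_image_sphere {T : Type*} [Fintype T] (hj : j ≤ Fintype.card T)
    {G : EuclideanSpace ℝ (Fin j) → T → ℝ} (hG : ContDiff ℝ 1 G) :
    Dense (G '' Metric.sphere 0 1)ᶜ := by
  rcases hj.lt_or_eq with hj | hj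
  · refine (hG.dense_compl_range_of_finrank_lt_finrank ?_).mono
      (Set.compl_subset_compl.2 (Set.image_subset_range _ _))
    rwa [finrank_euclideanSpace_fin, Module.finrank_fintype_fun_eq_card]
  · let e : (T → ℝ) ≃L[ℝ] EuclideanSpace ℝ (Fin j) := ContinuousLinearEquiv.ofFinrankEq (by
      rw [finrank_euclideanSpace_fin, Module.finrank_fintype_fun_eq_card, hj])
    have h0 : MeasureTheory.volume ((e ∘ G) '' Metric.sphere 0 1) = 0 :=
      MeasureTheory.addHaar_image_eq_zero_of_differentiableOn_of_addHaar_eq_zero _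
        ((e.differentiable.comp (hG.differentiable one_ne_zero)).differentiableOn)
        (MeasureTheory.Measure.addHaar_sphere_of_ne_zero _ _ one_ne_zero)
    have h1 : Dense ((e ∘ G) '' Metric.sphere 0 1)ᶜ :=
      MeasureTheory.Measure.dense_of_ae (MeasureTheory.compl_mem_ae_iff.2 h0)
    convert h1.preimage e.toHomeomorph.isOpenMap using 1
    ext y
    simp

end Sphere

/-! ### Realizations: passing a free face -/

section Polyhedron

variable {ι : Type*} [Fintype ι]

/-- The union of the closed simplices spanned by the members of a family of finite sets. -/
def polyhedron (F : Set (Finset ι)) : Set (ι → ℝ) :=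
  {x | x ∈ stdSimplex ℝ ι ∧ ∃ σ ∈ F, ∀ v, v ∉ σ → x v = 0}

theorem polyhedron_mono {F F' : Set (Finset ι)} (h : F ⊆ F') : polyhedron F ⊆ polyhedron F' :=
  fun _ hx => ⟨hx.1, hx.2.imp fun _ hσ => ⟨h hσ.1, hσ.2⟩⟩

variable [DecidableEq ι]

/-- Subtract the least coordinate on `τ` from all coordinates of `τ` and give the total to `y`. This
retracts the new faces onto `L`, and fixes `L` because a point there has a zero coordinate on `τ`.
-/
theorem ExtendsToBall.polyhedron_collapse {j : ℕ} {L : Set (Finset ι)} {τ : Finset ι} {y : ι}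
    (hne : τ.Nonempty) (hL : ∀ σ ∈ L, ∀ ρ ⊆ σ, ρ ∈ L) (hτ : τ ∉ L) (hy : y ∉ τ)
    (h : ∀ ρ ⊆ insert y τ, ρ ≠ τ → ρ ≠ insert y τ → ρ ∈ L)
    (hA : ∀ f : C(Metric.sphere (0 : EuclideanSpace ℝ (Fin j)) 1, polyhedron L), ExtendsToBall f)
    (f : C(Metric.sphere (0 : EuclideanSpace ℝ (Fin j)) 1, polyhedron (L ∪ {τ, insert y τ}))) :
    ExtendsToBall f := by
  let m : (ι → ℝ) → ℝ := fun x => τ.inf' hne x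
  have hm : Continuous m := Continuous.finset_inf'_apply hne fun v _ => continuous_apply v
  have hm_le : ∀ x, ∀ v ∈ τ, m x ≤ x v := fun x v hv => inf'_le _ hv
  let a : ι → ℝ := fun v => (if v ∈ τ then 1 else 0) - if v = y then (#τ : ℝ) else 0
  have ha0 : ∑ v, a v = 0 := by simp [a]
  have haτ : ∀ v ∈ τ, a v = 1 := fun v hv => by simp [a, hv, show v ≠ y from fun e => hy (e ▸ hv)]
  have han : ∀ v ∉ τ, a v ≤ 0 := fun v hv => by
    by_cases e : v = y <;> simp [a, hv, e, hy]
  have has : ∀ v ∉ insert y τ, a v = 0 := fun v hv => by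
    rw [mem_insert, not_or] at hv
    simp [a, hv]
  have hm0 : ∀ x ∈ polyhedron (L ∪ {τ, insert y τ}), 0 ≤ m x := fun x hx =>
    (le_inf'_iff _ _).2 fun v _ => hx.1.1 v
  have hdich : ∀ x ∈ polyhedron (L ∪ {τ, insert y τ}),
      (m x = 0 ∧ x ∈ polyhedron L) ∨ ∀ v ∉ insert y τ, x v = 0 := by
    rintro x ⟨hx, σ, hσ, hxσ⟩
    rcases hσ with hσ | rfl | rfl
    · obtain ⟨v, hvτ, hvσ⟩ := not_subset.1 fun h' => hτ (hL _ hσ _ h')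
      left
      refine ⟨le_antisymm ((hm_le x v hvτ).trans_eq (hxσ v hvσ)) ?_, hx, σ, hσ, hxσ⟩
      exact (le_inf'_iff _ _).2 fun v _ => hx.1 v
    · exact Or.inr fun v hv => hxσ v fun h' => hv (mem_insert_of_mem h')
    · exact Or.inr hxσ
  refine .of_deformation (polyhedron_mono Set.subset_union_left) f
    (fun p => (f p.2).1 - (p.1.1 * m (f p.2).1) • a) (by fun_prop) ?_ (by simp) ?_ hA
  · rintro ⟨⟨t, ht0, ht1⟩, x⟩
    obtain ⟨x, hx⟩ := f x
    show x - (t * m x) • a ∈ _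
    have hmx := hm0 x hx
    refine ⟨⟨fun v => ?_, ?_⟩, ?_⟩
    · simp only [Pi.sub_apply, Pi.smul_apply, smul_eq_mul]
      by_cases hv : v ∈ τ
      · rw [haτ v hv]
        have := hm_le x v hv
        nlinarith
      · have h1 := han v hv
        have h2 := hx.1.1 v
        have h3 : 0 ≤ t * m x := mul_nonneg ht0 hmx
        nlinarith
    · simp only [Pi.sub_apply, Pi.smul_apply, smul_eq_mul, sum_sub_distrib, ← mul_sum, ha0,
        hx.1.2, mul_zero, sub_zero]
    · rcases hdich x hx with ⟨h1, h2⟩ | h1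
      · simpa [h1] using hx.2
      · exact ⟨insert y τ, by simp, fun v hv => by simp [h1 v hv, has v hv]⟩
  · intro x
    obtain ⟨x, hx⟩ := f x
    show x - (1 * m x) • a ∈ _
    rw [one_mul]
    have hmx := hm0 x hx
    rcases hdich x hx with ⟨h1, h2⟩ | h1
    · simpa [h1] using h2
    obtain ⟨v, hv, hmv⟩ := exists_mem_eq_inf' hne x
    change m x = x v at hmv
    refine ⟨⟨fun w => ?_, ?_⟩, (insert y τ).erase v, ?_, fun w hw => ?_⟩
    · simp only [Pi.sub_apply, Pi.smul_apply, smul_eq_mul]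
      by_cases hw : w ∈ τ
      · rw [haτ w hw]
        linarith [hm_le x w hw]
      · have h1 := han w hw
        have h2 := hx.1.1 w
        nlinarith
    · simp only [Pi.sub_apply, Pi.smul_apply, smul_eq_mul, sum_sub_distrib, ← mul_sum, ha0,
        hx.1.2, mul_zero, sub_zero]
    · refine h _ (erase_subset _ _) (fun e => ?_) (fun e => ?_)
      · exact notMem_erase v (insert y τ) (by rw [e]; exact hv)
      · exact notMem_erase v (insert y τ) (by rw [e]; exact mem_insert_of_mem hv)
    · simp only [Pi.sub_apply, Pi.smul_apply, smul_eq_mul]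
      by_cases e : w = v
      · rw [e, haτ v hv, hmv]; ring
      · have : w ∉ insert y τ := fun h' => hw (mem_erase.2 ⟨e, h'⟩)
        rw [h1 w this, has w this]; ring

end Polyhedron

/-! ### Realizations: attaching a cell, and connectivity -/

section Polyhedron

variable {ι : Type*}

section

variable [Fintype ι]

theorem support_of_mem_polyhedron_insert {L : Set (Finset ι)} {σ : Finset ι}
    {x : ι → ℝ} (hx : x ∈ polyhedron (insert σ L)) :
    x ∈ polyhedron L ∨ ∀ v ∉ σ, x v = 0 := by
  obtain ⟨hx, ρ, rfl | hρ, h⟩ := hx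
  · exact Or.inr h
  · exact Or.inl ⟨hx, ρ, hρ, h⟩

theorem exists_eq_zero_of_mem_polyhedron {L : Set (Finset ι)} {σ : Finset ι}
    (hL : ∀ τ ∈ L, ∀ ρ ⊆ τ, ρ ∈ L) (hσ : σ ∉ L) {x : ι → ℝ} (hx : x ∈ polyhedron L) :
    ∃ v ∈ σ, x v = 0 := by
  obtain ⟨-, ρ, hρ, h⟩ := hx
  obtain ⟨v, hv, hv'⟩ := not_subset.1 fun h' => hσ (hL _ hρ _ h')
  exact ⟨v, hv, h v hv'⟩

end

variable [DecidableEq ι]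

/-- The point of the affine hull of the simplex `insert v₀ T` with the given coordinates on `T`. -/
def affinePoint (v₀ : ι) (T : Finset ι) (q : T → ℝ) (v : ι) : ℝ :=
  if h : v ∈ T then q ⟨v, h⟩ else if v = v₀ then 1 - ∑ w, q w else 0

theorem affinePoint_of_mem {v₀ : ι} {T : Finset ι} (q : T → ℝ) (v : T) :
    affinePoint v₀ T q v = q v := by simp [affinePoint]

theorem affinePoint_self {v₀ : ι} {T : Finset ι} (hv₀ : v₀ ∉ T) (q : T → ℝ) :
    affinePoint v₀ T q v₀ = 1 - ∑ w, q w := by simp [affinePoint, hv₀]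

theorem affinePoint_of_notMem {v₀ : ι} {T : Finset ι} (q : T → ℝ) {v : ι} (hv : v ∉ insert v₀ T) :
    affinePoint v₀ T q v = 0 := by
  rw [mem_insert, not_or] at hv
  simp [affinePoint, hv]

theorem continuous_affinePoint (v₀ : ι) (T : Finset ι) : Continuous (affinePoint v₀ T) := by
  refine continuous_pi fun v => ?_
  unfold affinePoint
  split_ifs <;> fun_prop

variable [Fintype ι]

theorem sum_eq_of_support {v₀ : ι} {T : Finset ι} (hv₀ : v₀ ∉ T) {x : ι → ℝ}
    (hx : ∀ v ∉ insert v₀ T, x v = 0) : ∑ v, x v = x v₀ + ∑ w : T, x w := by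
  rw [← sum_subset (subset_univ (insert v₀ T)) fun v _ hv => hx v hv, sum_insert hv₀,
    sum_coe_sort T]

theorem sum_affinePoint {v₀ : ι} {T : Finset ι} (hv₀ : v₀ ∉ T) (q : T → ℝ) :
    ∑ v, affinePoint v₀ T q v = 1 := by
  rw [sum_eq_of_support hv₀ fun v hv => affinePoint_of_notMem q hv, affinePoint_self hv₀]
  simp [affinePoint_of_mem]

/-- A map of a sphere into a polyhedron with a maximal simplex of larger dimension can be
homotoped so that it misses an interior point of that simplex. -/
theorem exists_homotopic_forall_ne {j : ℕ} {L : Set (Finset ι)} {v₀ : ι} {T : Finset ι}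
    (hv₀ : v₀ ∉ T) (hL : ∀ τ ∈ L, ∀ ρ ⊆ τ, ρ ∈ L) (hσ : insert v₀ T ∉ L) (hj : j ≤ #T)
    (f : C(Metric.sphere (0 : EuclideanSpace ℝ (Fin j)) 1, polyhedron (insert (insert v₀ T) L))) :
    ∃ p : ι → ℝ, (∀ v ∈ insert v₀ T, 0 < p v) ∧ (∀ v ∉ insert v₀ T, p v = 0) ∧ ∑ v, p v = 1 ∧
      ∃ g : C(Metric.sphere (0 : EuclideanSpace ℝ (Fin j)) 1,
        polyhedron (insert (insert v₀ T) L)), f.Homotopic g ∧ ∀ x, (g x).1 ≠ p := by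
  set N : ℝ := #T + 1 with hN
  have hN0 : 0 < N := by positivity
  -- The barycenter of the simplex has all coordinates `1 / N = 6 * ε`, so points with all
  -- coordinates above `3 * ε` form a nonempty open set.
  obtain ⟨ε, hε, hNε⟩ : ∃ ε : ℝ, 0 < ε ∧ N * (6 * ε) = 1 := 
    ⟨1 / (6 * N), by positivity, by field_simp⟩
  -- smooth approximation of the coordinates
  have happ : ∀ v : ι, ∃ G : EuclideanSpace ℝ (Fin j) → ℝ, ContDiff ℝ 1 G ∧
      ∀ x : Metric.sphere (0 : EuclideanSpace ℝ (Fin j)) 1, |G x - (f x).1 v| < ε / N :=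
    fun v => exists_contDiff_approx ⟨fun x => (f x).1 v,
      (continuous_apply v).comp (continuous_subtype_val.comp f.continuous)⟩ (by positivity)
  choose G hG hGf using happ
  let G' : EuclideanSpace ℝ (Fin j) → T → ℝ := fun x v => G v x
  have hG' : ContDiff ℝ 1 G' := contDiff_pi.2 fun v => hG v
  let F : EuclideanSpace ℝ (Fin j) → ι → ℝ := fun x => affinePoint v₀ T (G' x)
  have hF : Continuous F := (continuous_affinePoint v₀ T).comp hG'.continuous
  have hFf : ∀ x : Metric.sphere (0 : EuclideanSpace ℝ (Fin j)) 1,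
      (∀ v ∉ insert v₀ T, (f x).1 v = 0) → ∀ v ∈ insert v₀ T, |F x v - (f x).1 v| ≤ ε := by
    intro x hx v hv
    rcases mem_insert.1 hv with rfl | hv
    · have h1 := sum_eq_of_support hv₀ hx
      rw [(f x).2.1.2] at h1
      have h2 : F x v - (f x).1 v = ∑ w : T, ((f x).1 w - G' x w) := by
        simp only [F]
        rw [affinePoint_self hv₀, sum_sub_distrib]
        linarith
      rw [h2]
      refine (abs_sum_le_sum_abs _ _).trans ((sum_le_card_nsmul _ _ (ε / N) fun w _ => ?_).trans ?_)
      · rw [abs_sub_comm]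
        exact (hGf w x).le
      · rw [card_univ, Fintype.card_coe, nsmul_eq_mul, mul_div_assoc', div_le_iff₀ hN0]
        nlinarith
    · have h1 : F x v = G v x := affinePoint_of_mem (G' x) ⟨v, hv⟩
      rw [h1]
      refine (hGf v x).le.trans (div_le_self hε.le ?_)
      rw [hN]
      have : (0 : ℝ) ≤ #T := by positivity
      linarith
  -- the point to be missed
  obtain ⟨q, hqU, hqG⟩ : ∃ q : T → ℝ, ((∀ w, 3 * ε < q w) ∧ 3 * ε < 1 - ∑ w, q w) ∧
      q ∉ G' '' Metric.sphere 0 1 := by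
    have hopen : IsOpen {q : T → ℝ | (∀ w, 3 * ε < q w) ∧ 3 * ε < 1 - ∑ w, q w} := by
      have e : {q : T → ℝ | (∀ w, 3 * ε < q w) ∧ 3 * ε < 1 - ∑ w, q w} =
          (⋂ w, {q | 3 * ε < q w}) ∩ {q | 3 * ε < 1 - ∑ w, q w} := by
        ext q
        simp
      rw [e]
      exact (isOpen_iInter_of_finite fun w => isOpen_lt continuous_const (continuous_apply w)).inter
        (isOpen_lt continuous_const (by fun_prop))
    obtain ⟨q, h1, h2⟩ := (dense_compl_image_sphere
      (by rwa [Fintype.card_coe]) hG').inter_open_nonempty _ hopen ⟨fun _ => 6 * ε,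
        fun _ => by linarith, by
        simp only [sum_const, card_univ, Fintype.card_coe, nsmul_eq_mul]
        nlinarith⟩
    exact ⟨q, h1, h2⟩
  have hp : ∀ v ∈ insert v₀ T, 3 * ε < affinePoint v₀ T q v := by
    intro v hv
    rcases mem_insert.1 hv with rfl | hv
    · rw [affinePoint_self hv₀]
      exact hqU.2
    · rw [affinePoint_of_mem q ⟨v, hv⟩]
      exact hqU.1 _
  let m : (ι → ℝ) → ℝ := fun x => (insert v₀ T).inf' (insert_nonempty _ _) x
  have hm : Continuous m := Continuous.finset_inf'_apply _ fun v _ => continuous_apply v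
  have hm_le : ∀ x, ∀ v ∈ insert v₀ T, m x ≤ x v := fun x v hv => inf'_le _ hv
  -- Cutoff in terms of the least coordinate: no change near the boundary of the cell, full
  -- replacement by the smooth map once that coordinate reaches `2 * ε`.
  let l : ℝ → ℝ := fun a => max 0 (min 1 ((a - ε) / ε))
  have hl : Continuous l := by fun_prop
  have hl0 : ∀ a, 0 ≤ l a := fun a => le_max_left _ _
  have hl1 : ∀ a, l a ≤ 1 := fun a => max_le zero_le_one (min_le_left _ _)
  have hlz : ∀ a ≤ ε, l a = 0 := fun a ha =>
    max_eq_left ((min_le_right _ _).trans (div_nonpos_of_nonpos_of_nonneg (by linarith) hε.le))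
  have hlo : ∀ a, 2 * ε ≤ a → l a = 1 := fun a ha => by
    have : 1 ≤ (a - ε) / ε := by rw [le_div_iff₀ hε]; linarith
    simp [l, min_eq_left this]
  have hsupp : ∀ x ∈ polyhedron (insert (insert v₀ T) L), ε < m x →
      ∀ v ∉ insert v₀ T, x v = 0 := by
    intro x hx hmx
    refine (support_of_mem_polyhedron_insert hx).resolve_left fun h => ?_
    obtain ⟨v, hv, h⟩ := exists_eq_zero_of_mem_polyhedron hL hσ h
    linarith [hm_le x v hv]
  let H : unitInterval × Metric.sphere (0 : EuclideanSpace ℝ (Fin j)) 1 → ι → ℝ := fun p =>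
    (f p.2).1 + (p.1.1 * l (m (f p.2).1)) • (F p.2.1 - (f p.2).1)
  have hH : Continuous H := by fun_prop
  have hHB : ∀ p, H p ∈ polyhedron (insert (insert v₀ T) L) := by
    rintro ⟨⟨t, ht0, ht1⟩, x⟩
    change (f x).1 + (t * l (m (f x).1)) • (F x.1 - (f x).1) ∈ _
    rcases le_or_gt (m (f x).1) ε with h | h
    · rw [hlz _ h]
      simp
    · have hs := hsupp _ (f x).2 h
      have h0 : 0 ≤ t * l (m (f x).1) := mul_nonneg ht0 (hl0 _)
      have h1 : t * l (m (f x).1) ≤ 1 := mul_le_one₀ ht1 (hl0 _) (hl1 _)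
      set u := t * l (m (f x).1)
      have hz : ∀ v ∉ insert v₀ T, F x v = 0 := fun v hv => affinePoint_of_notMem _ hv
      refine ⟨⟨fun v => ?_, ?_⟩, insert v₀ T, Or.inl rfl, fun v hv => ?_⟩
      · simp only [Pi.add_apply, Pi.sub_apply, Pi.smul_apply, smul_eq_mul]
        by_cases hv : v ∈ insert v₀ T
        · have h2 := (abs_le.1 (hFf x hs v hv)).1
          have h3 := hm_le (f x).1 v hv
          have h4 : 0 ≤ F x v := by linarith
          have h5 : 0 ≤ (f x).1 v := by linarith
          nlinarith
        · simp [hs v hv, hz v hv]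
      · simp only [Pi.add_apply, Pi.sub_apply, Pi.smul_apply, smul_eq_mul, sum_add_distrib,
          ← mul_sum, sum_sub_distrib]
        rw [(f x).2.1.2, sum_affinePoint hv₀]
        ring
      · simp [hs v hv, hz v hv]
  refine ⟨affinePoint v₀ T q, fun v hv => by linarith [hp v hv],
    fun v hv => affinePoint_of_notMem q hv, sum_affinePoint hv₀ q, _,
    homotopic_of_forall_mem f H hH hHB (fun x => by simp [H]), fun x hx => ?_⟩
  change (f x).1 + (1 * l (m (f x).1)) • (F x.1 - (f x).1) = _ at hx
  rw [one_mul] at hx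
  have hclose : ∀ v ∈ insert v₀ T, affinePoint v₀ T q v - ε ≤ (f x).1 v := by
    intro v hv
    rcases le_or_gt (m (f x).1) ε with h | h
    · rw [hlz _ h, zero_smul, add_zero] at hx
      rw [hx]
      linarith
    · have h1 := abs_le.1 (hFf x (hsupp _ (f x).2 h) v hv)
      rw [← hx]
      simp only [Pi.add_apply, Pi.sub_apply, Pi.smul_apply, smul_eq_mul]
      have h2 := hl0 (m (f x).1)
      have h3 := hl1 (m (f x).1)
      nlinarith
  -- A point sent to the chosen one started within `ε` of it, so the cutoff is `1` there and the
  -- smooth map would attain `q`.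
  have hm2 : 2 * ε ≤ m (f x).1 := (le_inf'_iff _ _).2 fun v hv => by
    linarith [hclose v hv, hp v hv]
  rw [hlo _ hm2, one_smul, add_sub_cancel] at hx
  refine hqG ⟨x, x.2, funext fun w => ?_⟩
  rw [← affinePoint_of_mem (v₀ := v₀) q w, ← hx]
  exact (affinePoint_of_mem (G' x) w).symm

/-- Once the map misses an interior point `p` of the cell, radial projection from `p` pushes it into
the boundary, which lies in `L`. -/
theorem ExtendsToBall.polyhedron_cell {j : ℕ} {L : Set (Finset ι)} {σ : Finset ι}
    (hL : ∀ σ ∈ L, ∀ ρ ⊆ σ, ρ ∈ L) (hσ : σ ∉ L) (h : ∀ ρ ⊂ σ, ρ ∈ L) (hj : j < #σ)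
    (hA : ∀ f : C(Metric.sphere (0 : EuclideanSpace ℝ (Fin j)) 1, polyhedron L), ExtendsToBall f)
    (f : C(Metric.sphere (0 : EuclideanSpace ℝ (Fin j)) 1, polyhedron (insert σ L))) :
    ExtendsToBall f := by
  have hne : σ.Nonempty := card_pos.1 (by omega)
  obtain ⟨p, hp, hp0, hp1, g, hfg, hgp⟩ : ∃ p : ι → ℝ, (∀ v ∈ σ, 0 < p v) ∧
      (∀ v ∉ σ, p v = 0) ∧ ∑ v, p v = 1 ∧ ∃ g : C(Metric.sphere (0 : EuclideanSpace ℝ (Fin j)) 1,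
        polyhedron (insert σ L)), f.Homotopic g ∧ ∀ x, (g x).1 ≠ p := by
    obtain ⟨v₀, hv₀⟩ := hne
    obtain ⟨T, hT, rfl⟩ : ∃ T, v₀ ∉ T ∧ insert v₀ T = σ :=
      ⟨σ.erase v₀, notMem_erase _ _, insert_erase hv₀⟩
    rw [card_insert_of_notMem hT] at hj
    exact exists_homotopic_forall_ne hT hL hσ (by omega) f
  refine ExtendsToBall.of_homotopic hfg ?_
  -- The largest multiple of `p` that can be subtracted from `x` with coordinates staying
  -- nonnegative. It is less than `1` away from `p`, so the remainder can be renormalized.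
  let q : (ι → ℝ) → ℝ := fun x => σ.inf' hne fun v => x v / p v
  have hq : Continuous q := Continuous.finset_inf'_apply hne fun v _ => by fun_prop
  have hq_le : ∀ x, ∀ v ∈ σ, q x * p v ≤ x v := fun x v hv => by
    rw [← le_div_iff₀ (hp v hv)]
    exact inf'_le _ hv
  have hq_eq : ∀ x, ∃ v ∈ σ, x v = q x * p v := fun x => by
    obtain ⟨v, hv, e⟩ := exists_mem_eq_inf' hne fun v => x v / p v
    exact ⟨v, hv, by rw [← div_eq_iff (hp v hv).ne']; exact e.symm⟩
  have hq0 : ∀ x ∈ polyhedron (insert σ L), 0 ≤ q x := fun x hx =>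
    (le_inf'_iff _ _).2 fun v hv => div_nonneg (hx.1.1 v) (hp v hv).le
  have hqL : ∀ x ∈ polyhedron L, q x = 0 := fun x hx => by
    obtain ⟨v, hv, e⟩ := exists_eq_zero_of_mem_polyhedron hL hσ hx
    refine le_antisymm ?_ (hq0 x (polyhedron_mono (Set.subset_insert _ _) hx))
    have h1 := hq_le x v hv
    rw [e] at h1
    exact nonpos_of_mul_nonpos_left h1 (hp v hv)
  have hle : ∀ x ∈ polyhedron (insert σ L), ∀ v, q x * p v ≤ x v := fun x hx v => by
    by_cases hv : v ∈ σ
    · exact hq_le x v hv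
    · rw [hp0 v hv, mul_zero]
      exact hx.1.1 v
  have hq1 : ∀ x ∈ polyhedron (insert σ L), x ≠ p → q x < 1 := fun x hx hxp => by
    by_contra! h1
    refine hxp ?_
    have h2 : ∀ v, p v ≤ x v := fun v => by
      have h3 : 0 ≤ p v := by
        by_cases hv : v ∈ σ
        exacts [(hp v hv).le, (hp0 v hv).ge]
      nlinarith [hle x hx v]
    have h4 := (sum_eq_sum_iff_of_le fun v (_ : v ∈ univ) => h2 v).1 (by rw [hp1, hx.1.2])
    exact funext fun v => (h4 v (mem_univ v)).symm
  have hden : ∀ t : unitInterval, ∀ x, 0 < 1 - t.1 * q (g x).1 := fun t x => by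
    have h1 := hq1 _ (g x).2 (hgp x)
    have h2 := hq0 _ (g x).2
    have h3 := t.2.1
    have h4 := t.2.2
    nlinarith
  have hstd : ∀ t : unitInterval, ∀ x,
      (1 - t.1 * q (g x).1)⁻¹ • ((g x).1 - (t.1 * q (g x).1) • p) ∈
      stdSimplex ℝ ι := by
    intro t x
    have hd := hden t x
    refine ⟨fun v => ?_, ?_⟩
    · simp only [Pi.sub_apply, Pi.smul_apply, smul_eq_mul]
      refine mul_nonneg (inv_nonneg.2 hd.le) ?_
      have h1 := hle _ (g x).2 v
      have h2 := (g x).2.1.1 v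
      have h3 := t.2.1
      have h4 := t.2.2
      nlinarith
    · simp only [Pi.sub_apply, Pi.smul_apply, smul_eq_mul, ← mul_sum, sum_sub_distrib, hp1,
        (g x).2.1.2, mul_one]
      exact inv_mul_cancel₀ hd.ne'
  refine .of_deformation (polyhedron_mono (Set.subset_insert _ _)) g
    (fun a => (1 - a.1.1 * q (g a.2).1)⁻¹ • ((g a.2).1 - (a.1.1 * q (g a.2).1) • p)) ?_ ?_ (by simp)
    ?_ hA
  · refine Continuous.smul (Continuous.inv₀ (by fun_prop) fun a => (hden _ _).ne') (by fun_prop)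
  · rintro ⟨t, x⟩
    refine ⟨hstd t x, ?_⟩
    rcases support_of_mem_polyhedron_insert (g x).2 with h1 | h1
    · rw [hqL _ h1]
      simpa using (g x).2.2
    · exact ⟨σ, Or.inl rfl, fun v hv => by simp [h1 v hv, hp0 v hv]⟩
  · intro x
    refine ⟨hstd 1 x, ?_⟩
    rcases support_of_mem_polyhedron_insert (g x).2 with h1 | h1
    · rw [hqL _ h1]
      simpa using h1.2
    · obtain ⟨v, hv, e⟩ := hq_eq (g x).1
      refine ⟨σ.erase v, h _ (erase_ssubset hv), fun w hw => ?_⟩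
      by_cases hwv : w = v
      · rw [hwv]
        simp [e]
      · have : w ∉ σ := fun h' => hw (mem_erase.2 ⟨hwv, h'⟩)
        simp [h1 w this, hp0 w this]

theorem isNConnected_point {n : ℤ} (y : ι) :
    IsNConnected n (polyhedron ({∅, {y}} : Set (Finset ι))) := by
  have hsub : ∀ x ∈ polyhedron ({∅, {y}} : Set (Finset ι)), x = Pi.single y 1 := by
    rintro x ⟨hx, σ, hσ, h⟩
    have h' : ∀ v, v ≠ y → x v = 0 := by
      rcases hσ with rfl | rfl
      · exact fun v _ => h v (notMem_empty v)
      · exact fun v hv => h v (by simpa using hv)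
    have hy : x y = 1 := by
      rw [← hx.2]
      exact (sum_eq_single y (fun v _ hv => h' v hv) (by simp)).symm
    funext v
    by_cases hv : v = y
    · subst hv; simp [hy]
    · simp [h' v hv, hv]
  have hmem : (Pi.single y 1 : ι → ℝ) ∈ polyhedron ({∅, {y}} : Set (Finset ι)) :=
    ⟨single_mem_stdSimplex ℝ y, {y}, by simp, fun v hv => by simp at hv; simp [hv]⟩
  exact fun j _ f => ⟨ContinuousMap.const _ ⟨_, hmem⟩, fun x => Subtype.ext (hsub _ (f x).2).symm⟩

theorem MorseBuilt.isNConnected {n : ℤ} {F : Set (Finset ι)} (h : MorseBuilt n F)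
    (hF : F.Nonempty) : IsNConnected n (polyhedron F) := by
  induction h with
  | empty => exact absurd hF Set.not_nonempty_empty
  | @collapse L τ y hL hτ hy h ih =>
    rcases L.eq_empty_or_nonempty with rfl | hne
    · obtain rfl : τ = ∅ := by
        by_contra hne
        exact h ∅ (empty_subset _) (Ne.symm hne) (insert_ne_empty _ _).symm
      rw [Set.empty_union]
      exact isNConnected_point y
    · refine fun j hj => ExtendsToBall.polyhedron_collapse (nonempty_iff_ne_empty.2 ?_)
        (fun σ hσ ρ hρ => hL.mem_of_subset hσ hρ) hτ hy h (ih hne j hj)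
      rintro rfl
      exact hτ (hL.mem_of_subset hne.some_mem (empty_subset _))
  | @cell L σ hL hσ h hn ih =>
    intro j hj
    rcases L.eq_empty_or_nonempty with rfl | hne
    · obtain rfl : σ = ∅ := by
        by_contra hne
        exact h ∅ (empty_ssubset.2 (nonempty_iff_ne_empty.2 hne))
      rw [card_empty] at hn
      omega
    · exact ExtendsToBall.polyhedron_cell (fun σ hσ ρ hρ => hL.mem_of_subset hσ hρ) hσ h (by omega)
        (ih hne j hj)

end Polyhedron

/-! ### The matroid of slot sets with few full rows -/

section FullRows

variable {ρ κ : Type*} [Fintype ρ] [Fintype κ] [DecidableEq ρ] [DecidableEq κ]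

/-- The rows of `ρ × κ` contained in `T`. -/
def fullRows (T : Finset (ρ × κ)) : Finset ρ := {i | ∀ j, (i, j) ∈ T}

theorem mem_fullRows {T : Finset (ρ × κ)} {i : ρ} : i ∈ fullRows T ↔ ∀ j, (i, j) ∈ T := by
  simp [fullRows]

theorem fullRows_mono {T T' : Finset (ρ × κ)} (h : T ⊆ T') : fullRows T ⊆ fullRows T' :=
  fun _ hi => mem_fullRows.2 fun j => h (mem_fullRows.1 hi j)

/-- If augmentation fails, `I` has `s` full rows and each element of `J` outside `I` would complete
its row in `I`. Comparing row by row gives `#J + s ≤ #I + #(fullRows J)`, against `#I < #J`. With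
`κ` empty every row would be full, even in the empty set. -/
theorem isIndepFamily_card_fullRows_le [Nonempty κ] (s : ℕ) :
    IsIndepFamily fun T : Finset (ρ × κ) => #(fullRows T) ≤ s where
  empty := by
    have : fullRows (∅ : Finset (ρ × κ)) = ∅ := by
      ext i
      simp [mem_fullRows]
    simp [this]
  subset := fun hJ h => (card_le_card (fullRows_mono h)).trans hJ
  aug := by
    intro I J hI hJ hIJ
    by_contra! hcon
    obtain ⟨e, heJ, heI⟩ := exists_mem_notMem_of_card_lt_card hIJ
    -- adding an element of `J \ I` to `I` completes its row
    have hnew : ∀ e ∈ J, e ∉ I → ∀ j, (e.1, j) ∈ insert e I := by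
      intro e heJ heI
      by_contra hrow
      refine (hcon e heJ heI).not_ge ((card_le_card fun i hi => ?_).trans hI)
      rw [mem_fullRows] at hi ⊢
      have hie : i ≠ e.1 := fun h => hrow (h ▸ hi)
      exact fun j => (mem_insert.1 (hi j)).resolve_left fun h => hie (congrArg Prod.fst h)
    have hIs : s ≤ #(fullRows I) := by
      have h1 : fullRows (insert e I) ⊆ insert e.1 (fullRows I) := by
        intro i hi
        rw [mem_fullRows] at hi
        by_cases hie : i = e.1
        · simp [hie]
        · refine mem_insert_of_mem (mem_fullRows.2 fun j => (mem_insert.1 (hi j)).resolve_left ?_)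
          exact fun h => hie (congrArg Prod.fst h)
      have h2 := (card_le_card h1).trans (card_insert_le _ _)
      have h3 := hcon e heJ heI
      omega
    have hrow : ∀ i, #{e ∈ J | e.1 = i} + (if i ∈ fullRows I then 1 else 0) ≤
        #{e ∈ I | e.1 = i} + (if i ∈ fullRows J then 1 else 0) := by
      intro i
      have hfull : ∀ T : Finset (ρ × κ), i ∈ fullRows T →
          ({e ∈ T | e.1 = i} : Finset (ρ × κ)) = ({e | e.1 = i} : Finset (ρ × κ)) := by
        intro T hT
        ext ⟨a, b⟩
        simp only [mem_filter, mem_univ, true_and, and_iff_right_iff_imp]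
        rintro rfl
        exact mem_fullRows.1 hT b
      by_cases hsub : ({e ∈ J | e.1 = i} : Finset (ρ × κ)) ⊆ {e ∈ I | e.1 = i}
      · by_cases hiJ : i ∈ fullRows J
        · have := card_le_card hsub
          split_ifs <;> omega
        · by_cases hiI : i ∈ fullRows I
          · rw [if_pos hiI, if_neg hiJ, add_zero]
            refine card_lt_card (hsub.ssubset_of_ne fun h => hiJ (mem_fullRows.2 fun j => ?_))
            have : (i, j) ∈ ({e ∈ J | e.1 = i} : Finset (ρ × κ)) := by
              rw [h]
              simpa using mem_fullRows.1 hiI j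
            exact (mem_filter.1 this).1
          · rw [if_neg hiI, if_neg hiJ]
            simpa using card_le_card hsub
      · obtain ⟨e, he, he'⟩ := not_subset.1 hsub
        obtain ⟨heJ, rfl⟩ := mem_filter.1 he
        have heI : e ∉ I := fun h => he' (mem_filter.2 ⟨h, rfl⟩)
        have hiI : e.1 ∉ fullRows I := fun h => heI (mem_fullRows.1 h e.2)
        have h1 : ({e' | e'.1 = e.1} : Finset (ρ × κ)) = insert e {e' ∈ I | e'.1 = e.1} := by
          ext ⟨a, b⟩
          have := hnew e heJ heI b
          simp only [mem_filter, mem_univ, true_and, mem_insert] at this ⊢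
          constructor
          · rintro rfl
            exact this.imp_right fun h => ⟨h, rfl⟩
          · rintro (h | h)
            exacts [congrArg Prod.fst h, h.2]
        have h2 := congrArg card h1
        rw [card_insert_of_notMem he'] at h2
        rw [if_neg hiI, add_zero]
        by_cases hiJ : e.1 ∈ fullRows J
        · rw [if_pos hiJ, hfull J hiJ, h2]
        · rw [if_neg hiJ, add_zero]
          have h3 : ({e' ∈ J | e'.1 = e.1} : Finset (ρ × κ)) ⊂
              ({e' | e'.1 = e.1} : Finset (ρ × κ)) := by
            refine (filter_subset_filter _ (subset_univ _)).ssubset_of_ne fun h => hiJ ?_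
            refine mem_fullRows.2 fun j => ?_
            have : (e.1, j) ∈ ({e' ∈ J | e'.1 = e.1} : Finset (ρ × κ)) := by
              rw [h]
              simp
            exact (mem_filter.1 this).1
          have h4 := card_lt_card h3
          omega
    have hsum := sum_le_sum fun i (_ : i ∈ univ) => hrow i
    have hcard : ∀ T : Finset (ρ × κ), ∑ i, #{e ∈ T | e.1 = i} = #T := fun T =>
      (card_eq_sum_card_fiberwise fun _ _ => mem_coe.2 (mem_univ _)).symm
    rw [sum_add_distrib, sum_add_distrib, hcard, hcard] at hsum
    simp only [sum_ite_mem, univ_inter, sum_const, smul_eq_mul, mul_one] at hsum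
    omega

theorem exists_card_fullRows_le {r k s : ℕ} (hsr : s ≤ r) :
    ∃ I : Finset (Fin r × Fin (k + 1)), #(fullRows I) ≤ s ∧ #I = r * k + s := by
  have hs : #({i | i.1 < s} : Finset (Fin r)) = s := by
    simpa [hsr] using Fin.card_filter_val_lt (n := r) (m := s)
  -- All columns but one in every row, and the last column in the first `s` rows only.
  refine ⟨univ ×ˢ univ.erase 0 ∪ ({i | i.1 < s} : Finset (Fin r)) ×ˢ {0}, ?_, ?_⟩
  · refine (card_le_card fun i hi => ?_).trans_eq hs
    simpa using mem_fullRows.1 hi 0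
  · rw [card_union_of_disjoint, card_product, card_product, hs]
    · simp
    · rw [disjoint_left]
      rintro ⟨i, j⟩ h1 h2
      simp only [mem_product, mem_erase, mem_singleton] at h1 h2
      exact h1.2.1 h2.2

end FullRows

/-! ### The configuration space as a complex of fillings -/

section ConfigurationSpace

variable {V : Type*} {k r : ℕ}

theorem isRainbow_iff {c : V → Fin (k + 1)} {A : Finset V} :
    IsRainbow c A ↔ ∀ v ∈ A, ∀ w ∈ A, c v = c w → v = w := by
  simp only [IsRainbow, card_le_one, mem_filter]
  constructor
  · exact fun h v hv w hw e => h (c w) v ⟨hv, e⟩ w ⟨hw, rfl⟩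
  · exact fun h i v hv w hw => h v hv.1 w hw.1 (hv.2.trans hw.2.symm)

theorem IsRainbow.card_eq_iff {c : V → Fin (k + 1)} {A : Finset V} (h : IsRainbow c A) :
    #A = k + 1 ↔ ∀ j, ∃ v ∈ A, c v = j := by
  have h1 : #(A.image c) = #A := card_image_of_injOn fun v hv w hw e => isRainbow_iff.1 h v hv w hw e
  rw [← h1]
  constructor
  · intro h2 j
    have h3 : A.image c = univ := eq_univ_of_card _ (by simpa using h2)
    exact mem_image.1 (h3 ▸ mem_univ j)
  · intro h2
    have h3 : A.image c = univ := eq_univ_of_forall fun j => mem_image.2 (h2 j)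
    rw [h3]
    simp

variable [Fintype V] [DecidableEq V]

theorem mem_joinPart {σ : Finset (Fin r × V)} {i : Fin r} {v : V} :
    v ∈ joinPart σ i ↔ (i, v) ∈ σ := by simp [joinPart]

theorem mem_configurationSpace_iff {c : V → Fin (k + 1)} {s : ℕ} {σ : Finset (Fin r × V)} :
    σ ∈ configurationSpace c r s ↔ σ.Nonempty ∧
      σ ∈ fillings c (fun T : Finset (Fin r × Fin (k + 1)) => #(fullRows T) ≤ s)
        {p | p.2 ∈ (univ : Finset V)} := by
  have hrainbow : (∀ i, IsRainbow c (joinPart σ i)) ↔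
      ∀ p ∈ σ, ∀ q ∈ σ, slot c p = slot c q → p = q := by
    simp only [isRainbow_iff, mem_joinPart, slot, Prod.forall, Prod.mk.injEq]
    constructor
    · rintro h i v hv i' w hw ⟨rfl, e⟩
      exact ⟨rfl, h i v hv w hw e⟩
    · exact fun h i v hv w hw e => (h i v hv i w hw ⟨rfl, e⟩).2
  have hdisj : (∀ i j, i ≠ j → Disjoint (joinPart σ i) (joinPart σ j)) ↔
      ∀ p ∈ σ, ∀ q ∈ σ, p.2 = q.2 → p = q := by
    simp only [disjoint_left, mem_joinPart, Prod.forall, Prod.mk.injEq]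
    constructor
    · rintro h i v hv i' w hw rfl
      exact ⟨by_contra fun e => h i i' e hv hw, rfl⟩
    · exact fun h i j hij v hv hw => hij (h i v hv j v hw rfl).1
  have hfull : (∀ i, IsRainbow c (joinPart σ i)) →
      ({i | #(joinPart σ i) = k + 1} : Finset (Fin r)) = fullRows (σ.image (slot c)) := by
    intro h
    ext i
    simp only [mem_filter, mem_univ, true_and, mem_fullRows, (h i).card_eq_iff, mem_joinPart,
      mem_image, slot, Prod.exists, Prod.mk.injEq]
    refine forall_congr' fun j => ⟨?_, ?_⟩
    · rintro ⟨v, hv, e⟩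
      exact ⟨i, v, hv, rfl, e⟩
    · rintro ⟨_, v, hv, rfl, e⟩
      exact ⟨v, hv, e⟩
  change (_ ∧ _ ∧ _ ∧ _) ↔ _ ∧ _ ∧ _ ∧ _ ∧ _
  rw [hdisj, hrainbow]
  constructor
  · rintro ⟨h1, h2, h3, h4⟩
    exact ⟨h1, fun _ _ => mem_univ _, h2, h3, (hfull (hrainbow.2 h3) ▸ h4 :)⟩
  · rintro ⟨h1, -, h2, h3, h4⟩
    exact ⟨h1, h2, h3, by rwa [hfull (hrainbow.2 h3)]⟩

end ConfigurationSpace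

theorem proposition3p2 {V : Type*} [Fintype V] [DecidableEq V] (r k s : ℕ)
    (hs : 0 < s) (hsr : s ≤ r)
    (c : V → Fin (k + 1)) (hc : ∀ i, #{v | c v = i} = 2 * r - 1) :
    IsNConnected ((r * k + s : ℕ) - 2 : ℤ)
      (geometricRealization (configurationSpace c r s)) := by
  obtain ⟨I, hI, hIcard⟩ := exists_card_fullRows_le (k := k) hsr
  have hind := isIndepFamily_card_fullRows_le (ρ := Fin r) (κ := Fin (k + 1)) s
  have hbuilt := morseBuilt_fillings (c := c) hind univ (fun T _ => subset_univ T) hI univ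
    fun j => by
      have : ({e | e.2 = j} : Finset (Fin r × Fin (k + 1))) = univ ×ˢ {j} := by
        ext ⟨a, b⟩
        rw [mem_product]
        simp
      rw [hc, this, card_product]
      simp
  rw [hIcard] at hbuilt
  have hne : (∅ : Finset (Fin r × V)) ∈ fillings c
      (fun T : Finset (Fin r × Fin (k + 1)) => #(fullRows T) ≤ s) {p | p.2 ∈ (univ : Finset V)} :=
    ⟨by simp, by simp, by simp, by simpa using hind.empty⟩
  have hset : geometricRealization (configurationSpace c r s) = polyhedron (fillings c
      (fun T : Finset (Fin r × Fin (k + 1)) => #(fullRows T) ≤ s)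
        {p | p.2 ∈ (univ : Finset V)}) := by
    ext x
    refine and_congr_right fun hx => exists_congr fun σ => ?_
    rw [mem_configurationSpace_iff]
    refine ⟨fun h => ⟨h.1.2, h.2⟩, fun h => ⟨⟨?_, h.1⟩, h.2⟩⟩
    -- The fillings include the empty face, which the configuration space omits; it carries no
    -- point, since coordinates sum to `1`.
    rw [nonempty_iff_ne_empty]
    rintro rfl
    have h1 := hx.2
    rw [sum_eq_zero fun v _ => h.2 v (notMem_empty v)] at h1
    exact zero_ne_one h1
  rw [hset]
  exact hbuilt.isNConnected ⟨_, hne⟩
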